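/- Let $X_1,\dots,X_T$ be i.i.d. $[0,1]$-valued random variables with expectation $\mu>0$, and for $t\in\{2,\dots,T\}$ let $$\overline X_t=\frac1t\sum_{s=1}^t X_s,\qquad S_t^2=\frac1{t-1}\sum_{s=1}^t\big(X_s-\overline X_t\big)^2 .$$ Let $\delta\in(0,1)$ and $\alpha\ge 0$, and suppose that $T\ge t_0$, where $$t_0=\left\lceil\frac{\alpha+2}{3\mu}\,\ln\!\Big(\frac1\delta\Big)\Big(\sqrt{9\alpha^2+114\alpha+192}+3\alpha+19\Big)\right\rceil+2 .$$ Let $\tau=\tau(T,\delta,\alpha)$ be the smallest $t\in\{2,\dots,T\}$ such that $$\frac{\overline X_t}{\alpha+1}\;\ge\;\sqrt2\,S_t\left(\frac{\ln(1/\delta)}{t}\right)^{1/2}+\frac73\,\frac{\ln(1/\delta)}{t-1}\qquad(\ast)$$ (with $\tau=\infty$ if there is no such $t$); thus $\tau$ is defined without knowledge of $\mu$. Then, with probability at least $1-3(T-1)\delta$, both of the following hold: 1. $\tau\le t_0$; 2. for all $t\in\{2,\dots,T\}$ such that $(\ast)$ holds, $$\Big(\frac{\alpha}{\alpha+1}\Big)\overline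 X_t<\mu<\Big(\frac{\alpha+2}{\alpha+1}\Big)\overline X_t .$$ Moreover $t_0=\mathcal O\big(\frac{\alpha^2}{\mu}\ln\frac1\delta\big)$, uniformly for $\alpha$ bounded away from $0$ and $\delta$ bounded away from $1$: for all $\alpha_0>0$ and $\delta_0<1$ there is a constant $C$, depending only on $\alpha_0$ and $\delta_0$, such that $t_0\le C\,\frac{\alpha^2}{\mu}\ln\frac1\delta$ for all $\alpha\ge\alpha_0$, all $\delta\in(0,\delta_0]$ and all $\mu\in(0,1]$. -/

import Mathlib

open MeasureTheory ProbabilityTheory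

noncomputable section

namespace MeanEstimation

/-- The mean of the first `t` of the `T` values `x`, for `1 ≤ t ≤ T`. -/
def sampleMean {T : ℕ} (x : Fin T → ℝ) (t : ℕ) : ℝ :=
  (1 / (t : ℝ)) * ∑ s : Fin T with s.val < t, x s

/-- The (unbiased) sample variance `S_t²` of the first `t` of the `T` values `x`,
for `2 ≤ t ≤ T`. -/
def sampleVar {T : ℕ} (x : Fin T → ℝ) (t : ℕ) : ℝ :=
  (1 / ((t : ℝ) - 1)) * ∑ s : Fin T with s.val < t, (x s - sampleMean x t) ^ 2

/-- The empirical-Bernstein width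
`√2 S_t (ln(1/δ)/t)^{1/2} + (7/3) ln(1/δ)/(t-1)`, for `2 ≤ t ≤ T`. -/
def width {T : ℕ} (δ : ℝ) (x : Fin T → ℝ) (t : ℕ) : ℝ :=
  √2 * √(sampleVar x t) * √(Real.log (1 / δ) / t)
    + 7 / 3 * (Real.log (1 / δ) / ((t : ℝ) - 1))

/-- The stopping condition at time `t`. -/
def StopCond {T : ℕ} (δ α : ℝ) (x : Fin T → ℝ) (t : ℕ) : Prop :=
  width δ x t ≤ sampleMean x t / (α + 1)

/-- The smallest `t ∈ {2, …, T}` at which the stopping condition holds; it is `⊤` if there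
is none. It is computed from the sample, `T`, `δ` and `α` alone. -/
def stopTime {T : ℕ} (δ α : ℝ) (x : Fin T → ℝ) : ℕ∞ :=
  ⨅ t ∈ {t : ℕ | 2 ≤ t ∧ t ≤ T ∧ StopCond δ α x t}, (t : ℕ∞)

/-- The sample size `t₀`. -/
def sampleBound (μ δ α : ℝ) : ℕ :=
  ⌈(α + 2) / (3 * μ) * Real.log (1 / δ)
      * (√(9 * α ^ 2 + 114 * α + 192) + 3 * α + 19)⌉₊ + 2

end MeanEstimation

end

namespace MeanEstimation

/-! Write L = ln(1/δ) and let v be the common variance. For a fixed t, outside an event of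
probability at most 3δ, the error of the sample mean is below √(2vL/t) + L/(3t) on both sides
(`bernstein`), and √v < S_t + √(2L/(t-1)) (`sqrt_unbiasedVar_lower_tail`). Inserting the latter in
the former replaces the unknown √v by S_t and raises the constant 1/3 to 7/3, so the error is below
the width in (∗). A union bound over the T - 1 times costs 3(T-1)δ; the rest is deterministic.

Whenever (∗) holds, the error is below the sample mean divided by α + 1, which is conclusion 2. For
conclusion 1, (∗) must hold at t₀. Since the values lie in [0,1], v ≤ μ and S_t² is at most t/(t-1)
times the sample mean, so (∗) follows from a quadratic inequality in √μ, whose larger root dictates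
t₀.

The lower tail of S_t uses Hoeffding's device: the sample variance is an average, over permutations,
of means of ⌊n/2⌋ independent half squared differences, and Jensen's inequality reduces its Laplace
transform to that of a single pair. -/

/-! ### Exponential estimates and Bernstein's inequality. -/

lemma exp_neg_le_quadratic {y : ℝ} (hy : 0 ≤ y) : Real.exp (-y) ≤ 1 - y + y ^ 2 / 2 := by
  have h := Real.quadratic_le_exp_of_nonneg hy
  have h4 : (1 + y + y ^ 2 / 2) * (1 - y + y ^ 2 / 2) = 1 + y ^ 4 / 4 := by ring
  have h5 : 0 < 1 - y + y ^ 2 / 2 := by nlinarith [sq_nonneg (y - 1)]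
  rw [Real.exp_neg, inv_le_comm₀ (Real.exp_pos y) h5]
  refine le_trans ?_ h
  rw [inv_le_iff_one_le_mul₀ h5]
  nlinarith [sq_nonneg (y ^ 2)]

/-- Since (n+2)! ≥ 2·3ⁿ, the exponential series from degree 2 on is dominated by a geometric series
of ratio y/3. -/
lemma exp_le_geometric {y : ℝ} (hy : 0 ≤ y) (hy3 : y < 3) :
    Real.exp y ≤ 1 + y + y ^ 2 / (2 * (1 - y / 3)) := by
  have h1 : HasSum (fun n : ℕ => y ^ n / (n.factorial : ℝ)) (Real.exp y) := by
    have := NormedSpace.exp_series_hasSum_exp' (𝕂 := ℝ) y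
    rw [← Real.exp_eq_exp_ℝ] at this
    simpa only [smul_eq_mul, div_eq_inv_mul] using this
  have h2 : HasSum (fun n : ℕ => y ^ (n + 2) / ((n + 2).factorial : ℝ))
      (Real.exp y - (1 + y)) := by
    have := (hasSum_nat_add_iff' 2).2 h1
    simpa [Finset.sum_range_succ] using this
  have h3 : HasSum (fun n : ℕ => y ^ 2 / 2 * (y / 3) ^ n) (y ^ 2 / 2 * (1 - y / 3)⁻¹) :=
    (hasSum_geometric_of_lt_one (by positivity) (by linarith)).mul_left _
  have h4 : ∀ n : ℕ, (2 : ℝ) * 3 ^ n ≤ ((n + 2).factorial : ℝ) := fun n => by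
    have := Nat.factorial_mul_pow_le_factorial (m := 2) (n := n)
    rw [add_comm n 2]
    exact_mod_cast this
  have h5 := hasSum_le (fun n => by
    have : y ^ (n + 2) / ((n + 2).factorial : ℝ) ≤ y ^ (n + 2) / (2 * 3 ^ n) :=
      div_le_div_of_nonneg_left (by positivity) (by positivity) (h4 n)
    refine this.trans (le_of_eq ?_)
    rw [div_pow]
    rw [pow_add]
    field_simp) h2 h3
  have h6 : y ^ 2 / (2 * (1 - y / 3)) = y ^ 2 / 2 * (1 - y / 3)⁻¹ := by
    rw [div_mul_eq_div_div, div_eq_mul_inv (y ^ 2 / 2)]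
  linarith

/-- The pointwise inequality behind Bernstein's inequality. -/
lemma exp_le_bernstein {y c : ℝ} (hc : 0 ≤ c) (hc3 : c < 3) (hyc : y ≤ c) :
    Real.exp y ≤ 1 + y + y ^ 2 / (2 * (1 - c / 3)) := by
  have hpos : 0 < 1 - c / 3 := by linarith
  rcases le_total 0 y with hy | hy
  · refine (exp_le_geometric hy (by linarith)).trans ?_
    gcongr
  · have h := exp_neg_le_quadratic (neg_nonneg.2 hy)
    rw [neg_neg] at h
    have : y ^ 2 / 2 ≤ y ^ 2 / (2 * (1 - c / 3)) := by
      apply div_le_div_of_nonneg_left (sq_nonneg y) (by linarith) (by linarith)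
    nlinarith

variable {Ω : Type*} [MeasurableSpace Ω] {P : Measure Ω} [IsProbabilityMeasure P]

lemma integrable_of_abs_le {f : Ω → ℝ} (hf : Measurable f) (C : ℝ) (h : ∀ ω, |f ω| ≤ C) :
    Integrable f P :=
  Integrable.of_bound hf.aestronglyMeasurable C (Filter.Eventually.of_forall h)

lemma mgf_le_bernstein {Y : Ω → ℝ} (hm : Measurable Y) (hb : ∀ ω, |Y ω| ≤ 1)
    (h0 : ∫ ω, Y ω ∂P = 0) {c : ℝ} (hc : 0 ≤ c) (hc3 : c < 3) :
    mgf Y P c ≤ Real.exp (c ^ 2 * (∫ ω, Y ω ^ 2 ∂P) / (2 * (1 - c / 3))) := by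
  have hi1 : Integrable Y P := integrable_of_abs_le hm 1 hb
  have hi2 : Integrable (fun ω => Y ω ^ 2) P :=
    integrable_of_abs_le (hm.pow_const 2) 1 fun ω => by
      rw [abs_pow]; exact pow_le_one₀ (abs_nonneg _) (hb ω)
  have hi3 : Integrable (fun ω => Real.exp (c * Y ω)) P :=
    integrable_of_abs_le (by fun_prop) (Real.exp c) fun ω => by
      rw [abs_of_pos (Real.exp_pos _)]
      exact Real.exp_le_exp.2 (by nlinarith [abs_le.1 (hb ω)])
  have key : ∫ ω, Real.exp (c * Y ω) ∂P
      ≤ ∫ ω, (1 + c * Y ω + c ^ 2 / (2 * (1 - c / 3)) * Y ω ^ 2) ∂P := by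
    refine integral_mono hi3 (((integrable_const _).add (hi1.const_mul c)).add
      (hi2.const_mul _)) fun ω => ?_
    have := exp_le_bernstein hc hc3 (y := c * Y ω) (by nlinarith [abs_le.1 (hb ω)])
    refine this.trans (le_of_eq ?_)
    ring
  have hlin : Integrable (fun ω => 1 + c * Y ω) P := (integrable_const _).add (hi1.const_mul c)
  rw [integral_add hlin (hi2.const_mul _),
    integral_add (integrable_const _) (hi1.const_mul c), integral_const_mul, integral_const_mul,
    h0] at key
  simp only [integral_const, probReal_univ, smul_eq_mul, mul_one, mul_zero, add_zero] at key
  refine key.trans ?_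
  have := Real.add_one_le_exp (c ^ 2 * (∫ ω, Y ω ^ 2 ∂P) / (2 * (1 - c / 3)))
  refine le_trans (le_of_eq ?_) this
  ring

/-- Bernstein's inequality for independent centred variables bounded by `1`. -/
lemma bernstein {n : ℕ} {Y : Fin n → Ω → ℝ} (hm : ∀ i, Measurable (Y i))
    (hb : ∀ i ω, |Y i ω| ≤ 1) (h0 : ∀ i, ∫ ω, Y i ω ∂P = 0) (hind : iIndepFun Y P)
    {v : ℝ} (hv : ∀ i, ∫ ω, Y i ω ^ 2 ∂P = v) {L : ℝ} (hL : 0 < L) (hn : 0 < n) :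
    P.real {ω | √(2 * n * v * L) + L / 3 ≤ ∑ i, Y i ω} ≤ Real.exp (-L) := by
  have hn' : (0 : ℝ) < n := by exact_mod_cast hn
  have hv0 : 0 ≤ v := by
    rw [← hv ⟨0, hn⟩]; exact integral_nonneg fun ω => sq_nonneg _
  -- The Chernoff parameter below divides by v. If v = 0 the sum vanishes almost surely and cannot
  -- reach L/3 > 0.
  rcases hv0.eq_or_lt with hv1 | hv1
  · have hz : ∀ i, ∀ᵐ ω ∂P, Y i ω = 0 := fun i => by
      have h1 := (integral_eq_zero_iff_of_nonneg (fun ω => sq_nonneg (Y i ω))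
        (integrable_of_abs_le (P := P) ((hm i).pow_const 2) 1 fun ω => by
          rw [abs_pow]; exact pow_le_one₀ (abs_nonneg _) (hb i ω))).1 ((hv i).trans hv1.symm)
      filter_upwards [h1] with ω h
      simpa using h
    have : P {ω | √(2 * n * v * L) + L / 3 ≤ ∑ i, Y i ω} = 0 := by
      rw [measure_eq_zero_iff_ae_notMem]
      filter_upwards [ae_all_iff.2 hz] with ω h
      simp only [h, Finset.sum_const_zero, not_le]
      positivity
    rw [measureReal_def, this]
    simpa using (Real.exp_pos _).le
  · set r := √(2 * n * v * L) with hr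
    have hr2 : r ^ 2 = 2 * n * v * L := Real.sq_sqrt (by positivity)
    have hr0 : 0 < r := Real.sqrt_pos.2 (by positivity)
    -- With c = s/(1 + s/3) one has 1 - c/3 = 1/(1 + s/3), and the Chernoff exponent at level r +
    -- L/3 equals -L exactly.
    set s := r / (n * v) with hs
    have hs0 : 0 < s := by positivity
    set c := s / (1 + s / 3) with hc
    have hc0 : 0 < c := by positivity
    have hc3 : c < 3 := by
      rw [hc, div_lt_iff₀ (by positivity)]; linarith
    have h1c : 1 - c / 3 = 1 / (1 + s / 3) := by rw [hc]; field_simp; ring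
    have hmeas : Measurable (fun ω => ∑ i, Y i ω) := by fun_prop
    have hsum : ∀ ω, |∑ i, Y i ω| ≤ n := fun ω =>
      (Finset.abs_sum_le_sum_abs _ _).trans
        ((Finset.sum_le_sum fun i _ => hb i ω).trans (by simp))
    have h1 := measure_ge_le_exp_mul_mgf (μ := P) (X := fun ω => ∑ i, Y i ω) (r + L / 3) hc0.le
      (integrable_of_abs_le (by fun_prop) (Real.exp (c * n)) fun ω => by
        rw [abs_of_pos (Real.exp_pos _)]
        exact Real.exp_le_exp.2 (by nlinarith [abs_le.1 (hsum ω)]))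
    have h2 : mgf (fun ω => ∑ i, Y i ω) P c
        ≤ Real.exp (n * (c ^ 2 * v / (2 * (1 - c / 3)))) := by
      have : (fun ω => ∑ i, Y i ω) = ∑ i, Y i := by ext; simp
      rw [this, hind.mgf_sum hm]
      refine (Finset.prod_le_prod (fun i _ => mgf_nonneg) fun i _ =>
        mgf_le_bernstein (hm i) (hb i) (h0 i) hc0.le hc3).trans (le_of_eq ?_)
      simp [hv, ← Real.exp_nat_mul]
    refine h1.trans ((mul_le_mul_of_nonneg_left h2 (Real.exp_pos _).le).trans ?_)
    rw [← Real.exp_add]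
    refine Real.exp_le_exp.2 (le_of_eq ?_)
    have hrs : r = s * (n * v) := by rw [hs]; field_simp
    have hLs : L = s ^ 2 * (n * v) / 2 := by
      rw [hrs] at hr2
      field_simp at hr2 ⊢
      nlinarith
    rw [h1c, hc, hrs, hLs]
    field_simp
    ring

/-! ### The sample variance as an average over pairs. -/

/-- The unbiased sample variance of a vector. -/
noncomputable def unbiasedVar {n : ℕ} (x : Fin n → ℝ) : ℝ :=
  1 / ((n : ℝ) - 1) * ∑ i, (x i - 1 / (n : ℝ) * ∑ j, x j) ^ 2

lemma sum_sub_mean_sq {n : ℕ} (hn : 0 < n) (x : Fin n → ℝ) :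
    ∑ i, (x i - 1 / (n : ℝ) * ∑ j, x j) ^ 2 = ∑ i, x i ^ 2 - (∑ i, x i) ^ 2 / n := by
  have hn' : (n : ℝ) ≠ 0 := by positivity
  simp only [sub_sq, Finset.sum_add_distrib, Finset.sum_sub_distrib, ← Finset.sum_mul,
    ← Finset.mul_sum, Finset.sum_const, Finset.card_univ, Fintype.card_fin, nsmul_eq_mul]
  field_simp
  ring

lemma unbiasedVar_nonneg {n : ℕ} (hn : 2 ≤ n) (x : Fin n → ℝ) : 0 ≤ unbiasedVar x := by
  have : (2 : ℝ) ≤ n := by exact_mod_cast hn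
  exact mul_nonneg (div_nonneg zero_le_one (by linarith))
    (Finset.sum_nonneg fun i _ => sq_nonneg _)

lemma unbiasedVar_eq_sum_pairs {n : ℕ} (hn : 2 ≤ n) (x : Fin n → ℝ) :
    unbiasedVar x = (∑ i, ∑ j, (x i - x j) ^ 2 / 2) / (n * (n - 1)) := by
  have h2 : (2 : ℝ) ≤ n := by exact_mod_cast hn
  have h3 : (n : ℝ) - 1 ≠ 0 := by linarith
  rw [unbiasedVar, sum_sub_mean_sq (by omega)]
  have : ∑ i, ∑ j, (x i - x j) ^ 2 / 2 = n * ∑ i, x i ^ 2 - (∑ i, x i) ^ 2 := by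
    simp only [sub_sq, add_div, sub_div, Finset.sum_add_distrib, Finset.sum_sub_distrib,
      ← Finset.sum_mul, ← Finset.mul_sum, ← Finset.sum_div, Finset.sum_const, Finset.card_univ,
      Fintype.card_fin, nsmul_eq_mul]
    ring
  rw [this]
  field_simp

/-- Averaging a function of a pair of distinct indices over all permutations. -/
lemma sum_perm_pair {ι : Type*} [Fintype ι] [DecidableEq ι] (f : ι → ι → ℝ)
    (hf : ∀ i, f i i = 0) {a b : ι} (hab : a ≠ b) :
    (Fintype.card ι * (Fintype.card ι - 1) : ℝ) * ∑ σ : Equiv.Perm ι, f (σ a) (σ b)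
      = (Fintype.card (Equiv.Perm ι) : ℝ) * ∑ i, ∑ j, f i j := by
  -- The symmetric group is 2-transitive, so right translation shows the sum over σ to be the same
  -- for every pair of distinct indices.
  have hinv : ∀ p ∈ (Finset.univ : Finset ι).offDiag,
      ∑ σ : Equiv.Perm ι, f (σ p.1) (σ p.2) = ∑ σ : Equiv.Perm ι, f (σ a) (σ b) := by
    intro p hp
    obtain ⟨-, -, hp⟩ := Finset.mem_offDiag.1 hp
    obtain ⟨τ, h1, h2⟩ := MulAction.is_two_pretransitive_iff.1
      (Equiv.Perm.isMultiplyPretransitive ι 2) hab hp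
    rw [← h1, ← h2]
    exact Fintype.sum_equiv (Equiv.mulRight τ) _ _ fun σ => by simp
  have hoff : ∀ g : ι → ι → ℝ, (∀ i, g i i = 0) →
      ∑ p ∈ (Finset.univ : Finset ι).offDiag, g p.1 p.2 = ∑ i, ∑ j, g i j := by
    intro g hg
    rw [← Fintype.sum_prod_type']
    refine Finset.sum_subset (Finset.subset_univ _) fun p _ hp => ?_
    have : p.1 = p.2 := by simpa using hp
    rw [this, hg]
  have h1 := Finset.sum_congr rfl hinv
  rw [Finset.sum_const, Finset.sum_comm, Finset.offDiag_card, nsmul_eq_mul] at h1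
  have h2 : ∀ σ : Equiv.Perm ι, ∑ p ∈ (Finset.univ : Finset ι).offDiag, f (σ p.1) (σ p.2)
      = ∑ i, ∑ j, f i j := by
    intro σ
    rw [hoff (fun i j => f (σ i) (σ j)) fun i => hf _]
    rw [Equiv.sum_comp σ fun i => ∑ j, f i (σ j)]
    exact Finset.sum_congr rfl fun i _ => Equiv.sum_comp σ fun j => f i j
  rw [Finset.sum_congr rfl fun σ _ => h2 σ, Finset.sum_const, Finset.card_univ, nsmul_eq_mul] at h1
  rw [h1, Finset.card_univ, Nat.cast_sub (Nat.le_mul_self _)]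
  push_cast
  ring

/-! ### Lower tail of the sample standard deviation, and the joint deviation event. -/

/-- Injectivity of `e` makes the pairs disjoint, so at each induction step the new factor is
independent of the product of the earlier ones. -/
lemma integral_prod_disjoint_pairs {ι κ : Type*} [DecidableEq ι] [DecidableEq κ] {X : ι → Ω → ℝ}
    (hm : ∀ i, Measurable (X i)) (hind : iIndepFun X P) {e : κ × Bool → ι}
    (he : Function.Injective e) {g : ℝ × ℝ → ℝ} (hg : Measurable g) (J : Finset κ) :
    ∫ ω, ∏ i ∈ J, g (X (e (i, false)) ω, X (e (i, true)) ω) ∂P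
      = ∏ i ∈ J, ∫ ω, g (X (e (i, false)) ω, X (e (i, true)) ω) ∂P := by
  induction J using Finset.induction_on with
  | empty => simp
  | insert i J hi ih =>
    simp only [Finset.prod_insert hi]
    let S : Finset ι := {e (i, false), e (i, true)}
    let R : Finset ι := (J ×ˢ Finset.univ).image e
    have hmemR : ∀ j ∈ J, ∀ b, e (j, b) ∈ R := fun j hj b =>
      Finset.mem_image_of_mem _ (by simp [hj])
    have hSR : Disjoint S R := by
      rw [Finset.disjoint_left]
      intro a ha hR
      obtain ⟨⟨j, b⟩, hj, rfl⟩ := Finset.mem_image.1 hR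
      simp only [S, Finset.mem_insert, Finset.mem_singleton, he.eq_iff, Prod.mk.injEq] at ha
      simp only [Finset.mem_product, Finset.mem_univ, and_true] at hj
      rcases ha with ⟨rfl, -⟩ | ⟨rfl, -⟩ <;> exact hi hj
    let φ : (S → ℝ) → ℝ := fun u =>
      g (u ⟨e (i, false), by simp [S]⟩, u ⟨e (i, true), by simp [S]⟩)
    let ψ : (R → ℝ) → ℝ := fun u => ∏ j ∈ J.attach,
      g (u ⟨e (j, false), hmemR j j.2 _⟩, u ⟨e (j, true), hmemR j j.2 _⟩)
    have hφ : Measurable φ := by fun_prop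
    have hψ : Measurable ψ := by fun_prop
    have h := (hind.indepFun_finset S R hSR hm).comp hφ hψ
    have h1 : (ψ ∘ fun ω (a : R) => X a ω)
        = fun ω => ∏ j ∈ J, g (X (e (j, false)) ω, X (e (j, true)) ω) := by
      ext ω
      exact Finset.prod_attach J fun j => g (X (e (j, false)) ω, X (e (j, true)) ω)
    rw [h1] at h
    have := h.integral_fun_mul_eq_mul_integral
      (Measurable.aestronglyMeasurable (by fun_prop)) (Measurable.aestronglyMeasurable (by fun_prop))
    rw [ih] at this
    exact this

/-- The Laplace transform of `(X - Y)² / 2` for independent `X`, `Y` with equal first two moments. -/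
lemma integral_exp_neg_half_sq_sub_le {X Y : Ω → ℝ} (hX : Measurable X) (hY : Measurable Y)
    (hXb : ∀ ω, X ω ∈ Set.Icc (0 : ℝ) 1) (hYb : ∀ ω, Y ω ∈ Set.Icc (0 : ℝ) 1)
    (hind : IndepFun X Y P) {μ q : ℝ} (hX1 : ∫ ω, X ω ∂P = μ) (hY1 : ∫ ω, Y ω ∂P = μ)
    (hX2 : ∫ ω, X ω ^ 2 ∂P = q) (hY2 : ∫ ω, Y ω ^ 2 ∂P = q) {θ : ℝ} (hθ : 0 ≤ θ) :
    ∫ ω, Real.exp (-(θ * ((X ω - Y ω) ^ 2 / 2))) ∂P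
      ≤ Real.exp (-(θ * (q - μ ^ 2)) + θ ^ 2 * (q - μ ^ 2) / 4) := by
  have hiX2 : Integrable (fun ω => X ω ^ 2) P :=
    integrable_of_abs_le (by fun_prop) 1 fun ω => by
      rw [abs_pow, abs_of_nonneg (hXb ω).1]; exact pow_le_one₀ (hXb ω).1 (hXb ω).2
  have hiY2 : Integrable (fun ω => Y ω ^ 2) P :=
    integrable_of_abs_le (by fun_prop) 1 fun ω => by
      rw [abs_pow, abs_of_nonneg (hYb ω).1]; exact pow_le_one₀ (hYb ω).1 (hYb ω).2
  have hiXY : Integrable (fun ω => X ω * Y ω) P :=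
    integrable_of_abs_le (by fun_prop) 1 fun ω => by
      rw [abs_mul, abs_of_nonneg (hXb ω).1, abs_of_nonneg (hYb ω).1]
      exact mul_le_one₀ (hXb ω).2 (hYb ω).1 (hYb ω).2
  have hXY : ∫ ω, X ω * Y ω ∂P = μ * μ := by
    rw [hind.integral_fun_mul_eq_mul_integral hX.aestronglyMeasurable hY.aestronglyMeasurable,
      hX1, hY1]
  have hh : ∫ ω, (X ω - Y ω) ^ 2 / 2 ∂P = q - μ ^ 2 := by
    have : (fun ω => (X ω - Y ω) ^ 2 / 2)
        = fun ω => (1 / 2) * (X ω ^ 2 + Y ω ^ 2) - X ω * Y ω := by ext; ring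
    have hadd : Integrable (fun ω => X ω ^ 2 + Y ω ^ 2) P := hiX2.add hiY2
    rw [this, integral_sub (hadd.const_mul _) hiXY, integral_const_mul,
      integral_add hiX2 hiY2, hX2, hY2, hXY]
    ring
  have hhi : Integrable (fun ω => (X ω - Y ω) ^ 2 / 2) P :=
    integrable_of_abs_le (by fun_prop) 1 fun ω => by
      rw [abs_of_nonneg (by positivity)]
      obtain ⟨⟨a, b⟩, c, d⟩ := And.intro (hXb ω) (hYb ω)
      nlinarith
  have key : ∫ ω, Real.exp (-(θ * ((X ω - Y ω) ^ 2 / 2))) ∂P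
      ≤ ∫ ω, (1 + (-θ + θ ^ 2 / 4) * ((X ω - Y ω) ^ 2 / 2)) ∂P := by
    refine integral_mono ?_ ((integrable_const _).add (hhi.const_mul _)) fun ω => ?_
    · refine integrable_of_abs_le (by fun_prop) 1 fun ω => ?_
      rw [abs_of_pos (Real.exp_pos _), Real.exp_le_one_iff, neg_nonpos]
      positivity
    · have h0 : 0 ≤ (X ω - Y ω) ^ 2 / 2 := by positivity
      have h1 : (X ω - Y ω) ^ 2 / 2 ≤ 1 / 2 := by
        obtain ⟨⟨a, b⟩, c, d⟩ := And.intro (hXb ω) (hYb ω)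
        nlinarith
      refine (exp_neg_le_quadratic (mul_nonneg hθ h0)).trans ?_
      -- As 0 ≤ z ≤ 1/2, z² ≤ z/2: the second-order term becomes linear in z, whose mean is the
      -- variance.
      generalize (X ω - Y ω) ^ 2 / 2 = z at h0 h1
      nlinarith [mul_nonneg (sq_nonneg θ) (mul_nonneg h0 (sub_nonneg.2 h1))]
  rw [integral_add (integrable_const _) (hhi.const_mul _), integral_const_mul, hh] at key
  simp only [integral_const, probReal_univ, smul_eq_mul, mul_one] at key
  refine key.trans (le_trans (le_of_eq ?_) (Real.add_one_le_exp _))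
  ring

/-- The unbiased sample variance as an average over permutations of averages over disjoint
pairs. -/
lemma unbiasedVar_eq_average_perm {n k : ℕ} (hn : 2 ≤ n) (hk : 0 < k) {e : Fin k × Bool → Fin n}
    (he : Function.Injective e) (x : Fin n → ℝ) :
    unbiasedVar x = ∑ σ : Equiv.Perm (Fin n), (Fintype.card (Equiv.Perm (Fin n)) : ℝ)⁻¹ *
      ((∑ i, (x (σ (e (i, false))) - x (σ (e (i, true)))) ^ 2 / 2) / k) := by
  have h2 : (2 : ℝ) ≤ n := by exact_mod_cast hn
  have h3 : (n : ℝ) - 1 ≠ 0 := by linarith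
  have hk' : (k : ℝ) ≠ 0 := by positivity
  have hc : (Fintype.card (Equiv.Perm (Fin n)) : ℝ) ≠ 0 := by
    exact_mod_cast Fintype.card_ne_zero
  have hpair : ∀ i : Fin k, ∑ σ : Equiv.Perm (Fin n),
      (x (σ (e (i, false))) - x (σ (e (i, true)))) ^ 2 / 2
      = Fintype.card (Equiv.Perm (Fin n)) * unbiasedVar x := by
    intro i
    have := sum_perm_pair (fun a b => (x a - x b) ^ 2 / 2) (by simp)
      (he.ne (show (i, false) ≠ (i, true) by simp))
    rw [unbiasedVar_eq_sum_pairs hn, mul_div_assoc', ← this, Fintype.card_fin]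
    field_simp
  rw [← Finset.mul_sum, ← Finset.sum_div, Finset.sum_comm, Finset.sum_congr rfl fun i _ => hpair i]
  simp only [Finset.sum_const, Finset.card_univ, Fintype.card_fin, nsmul_eq_mul]
  field_simp

/-- Jensen's inequality moves the average over permutations outside the exponential; for each
permutation the k = ⌊n/2⌋ disjoint pairs factorise, each with parameter c/k. The resulting c²/(4k)
is at most c²/(2(n-1)) because n ≤ 2k + 1. -/
lemma integral_exp_neg_unbiasedVar_le {n : ℕ} (hn : 2 ≤ n) {X : Fin n → Ω → ℝ}
    (hm : ∀ i, Measurable (X i)) (hb : ∀ i ω, X i ω ∈ Set.Icc (0 : ℝ) 1) (hind : iIndepFun X P)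
    {μ q : ℝ} (h1 : ∀ i, ∫ ω, X i ω ∂P = μ) (h2 : ∀ i, ∫ ω, X i ω ^ 2 ∂P = q)
    (hv : 0 ≤ q - μ ^ 2) {c : ℝ} (hc : 0 ≤ c) :
    ∫ ω, Real.exp (-(c * unbiasedVar fun i => X i ω)) ∂P
      ≤ Real.exp (-(c * (q - μ ^ 2)) + c ^ 2 * (q - μ ^ 2) / (2 * (n - 1))) := by
  obtain ⟨k, hk0, hkn, hk⟩ : ∃ k : ℕ, 0 < k ∧ 2 * k ≤ n ∧ n ≤ 2 * k + 1 :=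
    ⟨n / 2, by omega, by omega, by omega⟩
  have hn2 : (2 : ℝ) ≤ n := by exact_mod_cast hn
  have hk0' : (0 : ℝ) < k := by exact_mod_cast hk0
  have hk' : (n : ℝ) ≤ 2 * k + 1 := by exact_mod_cast hk
  let e : Fin k × Bool → Fin n := fun p => ⟨2 * p.1.val + p.2.toNat, by
    have := p.1.2; have := p.2.toNat_le; omega⟩
  have he : Function.Injective e := by
    rintro ⟨i, b⟩ ⟨j, d⟩ h
    have h' : 2 * i.val + b.toNat = 2 * j.val + d.toNat := congrArg Fin.val h
    have hi : i = j := by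
      apply Fin.ext; have := b.toNat_le; have := d.toNat_le; omega
    subst hi
    cases b <;> cases d <;> simp_all
  let W : Equiv.Perm (Fin n) → Ω → ℝ := fun σ ω =>
    (∑ i, (X (σ (e (i, false))) ω - X (σ (e (i, true))) ω) ^ 2 / 2) / k
  have hW : ∀ σ ω, 0 ≤ W σ ω := fun σ ω => by positivity
  have hWm : ∀ σ, Measurable (W σ) := fun σ => by fun_prop
  have hWi : ∀ σ, Integrable (fun ω => Real.exp (-(c * W σ ω))) P := fun σ =>
    integrable_of_abs_le (by fun_prop) 1 fun ω => by
      rw [abs_of_pos (Real.exp_pos _), Real.exp_le_one_iff, neg_nonpos]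
      exact mul_nonneg hc (hW σ ω)
  set N : ℝ := (Fintype.card (Equiv.Perm (Fin n)) : ℝ) with hN
  have hN0 : 0 < N := by
    rw [hN]; exact_mod_cast Fintype.card_pos
  have hjensen : ∀ ω, Real.exp (-(c * unbiasedVar fun i => X i ω))
      ≤ ∑ σ, N⁻¹ * Real.exp (-(c * W σ ω)) := by
    intro ω
    have := convexOn_exp.map_sum_le (t := Finset.univ) (w := fun _ : Equiv.Perm (Fin n) => N⁻¹)
      (p := fun σ => -(c * W σ ω)) (fun _ _ => by positivity)
      (by rw [Finset.sum_const, Finset.card_univ, nsmul_eq_mul]; exact mul_inv_cancel₀ hN0.ne')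
      (fun _ _ => Set.mem_univ _)
    simp only [smul_eq_mul] at this
    refine le_trans (le_of_eq ?_) this
    rw [unbiasedVar_eq_average_perm hn hk0 he, Finset.mul_sum, ← Finset.sum_neg_distrib]
    congr 1
    exact Finset.sum_congr rfl fun σ _ => by simp only [W]; ring
  have hWle : ∀ σ, ∫ ω, Real.exp (-(c * W σ ω)) ∂P
      ≤ Real.exp (-(c * (q - μ ^ 2)) + c ^ 2 * (q - μ ^ 2) / (2 * (n - 1))) := by
    intro σ
    let g : ℝ × ℝ → ℝ := fun p => Real.exp (-(c / k * ((p.1 - p.2) ^ 2 / 2)))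
    have hprod : ∀ ω, Real.exp (-(c * W σ ω)) = ∏ i : Fin k,
        g (X ((σ ∘ e) (i, false)) ω, X ((σ ∘ e) (i, true)) ω) := by
      intro ω
      simp only [g]
      rw [← Real.exp_sum]
      congr 1
      simp only [W, Function.comp, Finset.sum_neg_distrib, ← Finset.mul_sum]
      ring
    rw [integral_congr_ae (Filter.Eventually.of_forall hprod),
      integral_prod_disjoint_pairs hm hind (σ.injective.comp he) (g := g) (by fun_prop)
        Finset.univ]
    refine (Finset.prod_le_prod (fun i _ => integral_nonneg fun ω => (Real.exp_pos _).le)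
      fun i _ => integral_exp_neg_half_sq_sub_le (hm _) (hm _) (hb _) (hb _)
        (hind.indepFun ((σ.injective.comp he).ne (show (i, false) ≠ (i, true) by simp)))
        (h1 _) (h1 _) (h2 _) (h2 _) (by positivity)).trans ?_
    rw [Finset.prod_const, Finset.card_univ, Fintype.card_fin, ← Real.exp_nat_mul,
      Real.exp_le_exp]
    have h3 : k * (-(c / k * (q - μ ^ 2)) + (c / k) ^ 2 * (q - μ ^ 2) / 4)
        = -(c * (q - μ ^ 2)) + c ^ 2 * (q - μ ^ 2) / (4 * k) := by
      field_simp
    rw [h3]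
    refine add_le_add le_rfl ?_
    exact div_le_div_of_nonneg_left (by positivity) (by linarith) (by linarith)
  calc ∫ ω, Real.exp (-(c * unbiasedVar fun i => X i ω)) ∂P
      ≤ ∫ ω, ∑ σ, N⁻¹ * Real.exp (-(c * W σ ω)) ∂P := by
        refine integral_mono_of_nonneg (Filter.Eventually.of_forall fun ω => (Real.exp_pos _).le)
          (integrable_finsetSum _ fun σ _ => (hWi σ).const_mul _)
          (Filter.Eventually.of_forall hjensen)
    _ = ∑ σ, N⁻¹ * ∫ ω, Real.exp (-(c * W σ ω)) ∂P := by
        rw [integral_finsetSum _ fun σ _ => (hWi σ).const_mul _]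
        simp only [integral_const_mul]
    _ ≤ ∑ _σ : Equiv.Perm (Fin n), N⁻¹ *
          Real.exp (-(c * (q - μ ^ 2)) + c ^ 2 * (q - μ ^ 2) / (2 * (n - 1))) := by
        gcongr with σ
        exact hWle σ
    _ = _ := by
        rw [Finset.sum_const, Finset.card_univ, nsmul_eq_mul, ← mul_assoc,
          mul_inv_cancel₀ hN0.ne', one_mul]

/-- Lower tail of the empirical standard deviation. -/
lemma sqrt_unbiasedVar_lower_tail {n : ℕ} (hn : 2 ≤ n) {X : Fin n → Ω → ℝ}
    (hm : ∀ i, Measurable (X i)) (hb : ∀ i ω, X i ω ∈ Set.Icc (0 : ℝ) 1) (hind : iIndepFun X P)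
    {μ q : ℝ} (h1 : ∀ i, ∫ ω, X i ω ∂P = μ) (h2 : ∀ i, ∫ ω, X i ω ^ 2 ∂P = q)
    (hv : 0 ≤ q - μ ^ 2) {L : ℝ} (hL : 0 < L) :
    P.real {ω | √(unbiasedVar fun i => X i ω) + √(2 * (L / (n - 1))) ≤ √(q - μ ^ 2)}
      ≤ Real.exp (-L) := by
  have hn2 : (2 : ℝ) ≤ n := by exact_mod_cast hn
  have hn1 : (0 : ℝ) < n - 1 := by linarith
  set d := √(2 * (L / (n - 1))) with hd
  have hd2 : d ^ 2 = 2 * (L / (n - 1)) := Real.sq_sqrt (by positivity)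
  have hd0 : 0 < d := Real.sqrt_pos.2 (by positivity)
  set s := √(q - μ ^ 2) with hs
  have hs2 : s ^ 2 = q - μ ^ 2 := Real.sq_sqrt hv
  rcases (Real.sqrt_nonneg (q - μ ^ 2)).eq_or_lt with h0 | h0
  · have : {ω | √(unbiasedVar fun i => X i ω) + d ≤ s} = ∅ := by
      ext ω
      simp only [Set.mem_ofPred_eq, Set.mem_empty_iff_false, iff_false, not_le, hs, ← h0]
      positivity
    rw [this]
    simpa using (Real.exp_pos _).le
  rw [← hs] at h0
  -- If S ≤ s - d, then S ≤ s as well, so S² ≤ s(s - d).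
  have hsub : {ω | √(unbiasedVar fun i => X i ω) + d ≤ s}
      ⊆ {ω | d * s - s ^ 2 ≤ -unbiasedVar fun i => X i ω} := by
    intro ω hω
    simp only [Set.mem_ofPred_eq] at hω ⊢
    have hr := Real.sqrt_nonneg (unbiasedVar fun i => X i ω)
    have hr2 := Real.sq_sqrt (unbiasedVar_nonneg hn fun i => X i ω)
    nlinarith
  -- This minimises the exponent -cds + c²s²/(2(n-1)); the minimum is -d²(n-1)/2 = -L.
  set c := d * (n - 1) / s with hc
  have hc0 : 0 < c := by positivity
  have hVm : Measurable fun ω => unbiasedVar fun i => X i ω := by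
    unfold unbiasedVar; fun_prop
  have h3 := measure_ge_le_exp_mul_mgf (μ := P) (X := fun ω => -unbiasedVar fun i => X i ω)
    (d * s - s ^ 2) hc0.le (integrable_of_abs_le (by fun_prop) 1 fun ω => by
      rw [abs_of_pos (Real.exp_pos _), Real.exp_le_one_iff, mul_neg, neg_nonpos]
      exact mul_nonneg hc0.le (unbiasedVar_nonneg hn _))
  have h4 := integral_exp_neg_unbiasedVar_le hn hm hb hind h1 h2 hv hc0.le
  rw [mgf] at h3
  simp only [mul_neg] at h3
  refine (measureReal_mono hsub).trans (h3.trans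
    ((mul_le_mul_of_nonneg_left h4 (Real.exp_pos _).le).trans ?_))
  rw [← Real.exp_add]
  refine Real.exp_le_exp.2 (le_of_eq ?_)
  have hLd : L = d ^ 2 * (n - 1) / 2 := by rw [hd2]; field_simp
  rw [← hs2, hc, hLd]
  field_simp
  ring

/-- The deviations of the sample mean and of the empirical standard deviation are
simultaneously small, except with probability `3 exp (-L)`. -/
lemma deviations_bound {n : ℕ} (hn : 2 ≤ n) {X : Fin n → Ω → ℝ}
    (hm : ∀ i, Measurable (X i)) (hb : ∀ i ω, X i ω ∈ Set.Icc (0 : ℝ) 1) (hind : iIndepFun X P)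
    {μ q : ℝ} (h1 : ∀ i, ∫ ω, X i ω ∂P = μ) (h2 : ∀ i, ∫ ω, X i ω ^ 2 ∂P = q)
    (hμ : μ ∈ Set.Icc (0 : ℝ) 1) {L : ℝ} (hL : 0 < L) :
    P.real {ω | ¬(∑ i, X i ω - n * μ < √(2 * n * (q - μ ^ 2) * L) + L / 3 ∧
        n * μ - ∑ i, X i ω < √(2 * n * (q - μ ^ 2) * L) + L / 3 ∧
        √(q - μ ^ 2) < √(unbiasedVar fun i => X i ω) + √(2 * (L / (n - 1))))}
      ≤ 3 * Real.exp (-L) := by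
  have hXi : ∀ i, Integrable (X i) P := fun i => integrable_of_abs_le (hm i) 1 fun ω => by
    rw [abs_of_nonneg (hb i ω).1]; exact (hb i ω).2
  have hXi2 : ∀ i, Integrable (fun ω => X i ω ^ 2) P := fun i =>
    integrable_of_abs_le ((hm i).pow_const 2) 1 fun ω => by
      rw [abs_pow, abs_of_nonneg (hb i ω).1]; exact pow_le_one₀ (hb i ω).1 (hb i ω).2
  have hvar : ∀ i, ∫ ω, (X i ω - μ) ^ 2 ∂P = q - μ ^ 2 := fun i => by
    have : (fun ω => (X i ω - μ) ^ 2) = fun ω => X i ω ^ 2 - 2 * μ * X i ω + μ ^ 2 := by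
      ext; ring
    have hs : Integrable (fun ω => X i ω ^ 2 - 2 * μ * X i ω) P :=
      (hXi2 i).sub ((hXi i).const_mul _)
    rw [this, integral_add hs (integrable_const _), integral_sub (hXi2 i) ((hXi i).const_mul _),
      integral_const_mul, h1, h2]
    simp
    ring
  have hv : 0 ≤ q - μ ^ 2 := by
    rw [← hvar ⟨0, by omega⟩]; exact integral_nonneg fun ω => sq_nonneg _
  have hup := bernstein (P := P) (Y := fun i ω => X i ω - μ) (fun i => (hm i).sub_const μ)
    (fun i ω => abs_le.2 ⟨by linarith [(hb i ω).1, hμ.2], by linarith [(hb i ω).2, hμ.1]⟩)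
    (fun i => by rw [integral_sub (hXi i) (integrable_const _), h1]; simp)
    (hind.comp (fun _ x => x - μ) fun _ => by fun_prop) hvar hL (by omega)
  have hlo := bernstein (P := P) (Y := fun i ω => μ - X i ω) (v := q - μ ^ 2) (fun i => (hm i).const_sub μ)
    (fun i ω => abs_le.2 ⟨by linarith [(hb i ω).2, hμ.1], by linarith [(hb i ω).1, hμ.2]⟩)
    (fun i => by rw [integral_sub (integrable_const _) (hXi i), h1]; simp)
    (hind.comp (fun _ x => μ - x) fun _ => by fun_prop)
    (fun i => by rw [← hvar i]; congr 1; ext ω; ring) hL (by omega)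
  have hsd := sqrt_unbiasedVar_lower_tail (P := P) hn hm hb hind h1 h2 hv hL
  simp only [Finset.sum_sub_distrib, Finset.sum_const, Finset.card_univ, Fintype.card_fin,
    nsmul_eq_mul] at hup hlo
  have hsub : {ω | ¬(∑ i, X i ω - n * μ < √(2 * n * (q - μ ^ 2) * L) + L / 3 ∧
        n * μ - ∑ i, X i ω < √(2 * n * (q - μ ^ 2) * L) + L / 3 ∧
        √(q - μ ^ 2) < √(unbiasedVar fun i => X i ω) + √(2 * (L / (n - 1))))}
      ⊆ ({ω | √(2 * n * (q - μ ^ 2) * L) + L / 3 ≤ ∑ i, X i ω - n * μ} ∪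
        {ω | √(2 * n * (q - μ ^ 2) * L) + L / 3 ≤ n * μ - ∑ i, X i ω}) ∪
        {ω | √(unbiasedVar fun i => X i ω) + √(2 * (L / (n - 1))) ≤ √(q - μ ^ 2)} := by
    intro ω hω
    simp only [Set.mem_ofPred_eq, Set.mem_union] at hω ⊢
    by_contra! h
    exact hω ⟨h.1.1, h.1.2, h.2⟩
  refine (measureReal_mono hsub).trans ((measureReal_union_le _ _).trans ?_)
  have := measureReal_union_le (μ := P)
    {ω | √(2 * n * (q - μ ^ 2) * L) + L / 3 ≤ ∑ i, X i ω - n * μ}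
    {ω | √(2 * n * (q - μ ^ 2) * L) + L / 3 ≤ n * μ - ∑ i, X i ω}
  linarith

/-! ### Statistics of an initial segment of the sample. -/

lemma sum_filter_lt_eq {T t : ℕ} (h : t ≤ T) (f : Fin T → ℝ) :
    ∑ s : Fin T with s.val < t, f s = ∑ i : Fin t, f (Fin.castLE h i) := by
  symm
  refine Finset.sum_bij (fun i _ => Fin.castLE h i) (by simp) (by simp) ?_ (by simp)
  intro s hs
  exact ⟨⟨s, by simpa using hs⟩, Finset.mem_univ _, rfl⟩

lemma sampleMean_eq {T t : ℕ} (h : t ≤ T) (x : Fin T → ℝ) :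
    sampleMean x t = 1 / (t : ℝ) * ∑ i : Fin t, x (Fin.castLE h i) := by
  rw [sampleMean, sum_filter_lt_eq h]

lemma sampleVar_eq {T t : ℕ} (h : t ≤ T) (x : Fin T → ℝ) :
    sampleVar x t = unbiasedVar fun i => x (Fin.castLE h i) := by
  rw [sampleVar, sum_filter_lt_eq h, sampleMean_eq h, unbiasedVar]

/-- On [0,1] one has x² ≤ x. The factor t/(t-1) later turns L/t into L/(t-1). -/
lemma sampleVar_le {T t : ℕ} (ht : 2 ≤ t) (h : t ≤ T) {x : Fin T → ℝ}
    (hx : ∀ s, x s ∈ Set.Icc (0 : ℝ) 1) :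
    sampleVar x t ≤ t / (t - 1) * sampleMean x t := by
  have ht2 : (2 : ℝ) ≤ t := by exact_mod_cast ht
  have ht1 : (0 : ℝ) < t - 1 := by linarith
  rw [sampleVar_eq h, sampleMean_eq h, unbiasedVar, sum_sub_mean_sq (by omega)]
  have h1 : ∑ i : Fin t, x (Fin.castLE h i) ^ 2 ≤ ∑ i : Fin t, x (Fin.castLE h i) :=
    Finset.sum_le_sum fun i _ => by nlinarith [(hx (Fin.castLE h i)).1, (hx (Fin.castLE h i)).2]
  have h2 : 0 ≤ (∑ i : Fin t, x (Fin.castLE h i)) ^ 2 / t := by positivity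
  have h3 : (t : ℝ) / (t - 1) * (1 / t * ∑ i : Fin t, x (Fin.castLE h i))
      = 1 / (t - 1) * ∑ i : Fin t, x (Fin.castLE h i) := by field_simp
  rw [h3]
  gcongr
  linarith

lemma sampleMean_nonneg {T : ℕ} (t : ℕ) {x : Fin T → ℝ} (hx : ∀ s, x s ∈ Set.Icc (0 : ℝ) 1) :
    0 ≤ sampleMean x t :=
  mul_nonneg (by positivity) (Finset.sum_nonneg fun s _ => (hx s).1)

/-! ### Deterministic analysis of the stopping condition. -/

lemma sqrt_bernstein_eq {t v L : ℝ} (ht : 0 < t) (hv : 0 ≤ v) :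
    √(2 * t * v * L) = t * (√2 * √v * √(L / t)) := by
  have : 2 * t * v * L = t ^ 2 * (2 * v * (L / t)) := by field_simp
  rw [this, Real.sqrt_mul (by positivity), Real.sqrt_sq ht.le, Real.sqrt_mul (by positivity),
    Real.sqrt_mul (by norm_num)]

/-- The deterministic passage from the true to the empirical standard deviation. -/
lemma bernstein_width_le {t v L S : ℝ} (ht : 2 ≤ t) (hL : 0 < L)
    (hsd : √v ≤ S + √(2 * (L / (t - 1)))) :
    √2 * √v * √(L / t) + L / (3 * t)
      ≤ √2 * S * √(L / t) + 7 / 3 * (L / (t - 1)) := by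
  have ht1 : 0 < t - 1 := by linarith
  set u := L / (t - 1) with hu
  have hu0 : 0 < u := by positivity
  have h1 : L / t ≤ u := div_le_div_of_nonneg_left hL.le ht1 (by linarith)
  have h2 : √(L / t) ≤ √u := Real.sqrt_le_sqrt h1
  have h3 : L / (3 * t) = L / t / 3 := by rw [mul_comm, div_mul_eq_div_div]
  -- This 2u, added to the u/3 from Bernstein's inequality, is the source of 7/3.
  have h4 : √2 * √(2 * u) * √u = 2 * u := by
    rw [Real.sqrt_mul (by norm_num), ← mul_assoc, mul_assoc, Real.mul_self_sqrt hu0.le,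
      Real.mul_self_sqrt (by norm_num)]
  have h5 : √2 * √v * √(L / t) ≤ √2 * (S + √(2 * u)) * √(L / t) := by gcongr
  have h6 : √2 * √(2 * u) * √(L / t) ≤ √2 * √(2 * u) * √u := by gcongr
  rw [h3]
  nlinarith

/-- `sampleBound` solves the quadratic inequality it is designed for. -/
lemma le_of_quadratic_root_le {μ u b : ℝ} (hμ : 0 ≤ μ) (hu : 0 ≤ u) (hb : 0 < b)
    (h : u * (b / 3 * (√(9 * b ^ 2 + 78 * b) + 3 * b + 13)) ≤ μ) :
    b * (√2 * √μ * √u + 13 / 3 * u) ≤ μ := by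
  set D := √(9 * b ^ 2 + 78 * b) with hD
  have hD2 : D ^ 2 = 9 * b ^ 2 + 78 * b := Real.sq_sqrt (by positivity)
  have hD3 : 3 * b ≤ D := Real.le_sqrt_of_sq_le (by nlinarith)
  set y := √μ with hy
  set w := √u with hw
  have hy0 : 0 ≤ y := Real.sqrt_nonneg _
  have hw0 : 0 ≤ w := Real.sqrt_nonneg _
  have hy2 : y ^ 2 = μ := Real.sq_sqrt hμ
  have hw2 : w ^ 2 = u := Real.sq_sqrt hu
  have h2 : √2 ^ 2 = (2 : ℝ) := Real.sq_sqrt (by norm_num)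
  have h20 : 0 < √(2 : ℝ) := by positivity
  -- The numbers w√2(3b ± D)/6 are the roots of y² - b√2wy - (13/3)bw²; the hypothesis places y = √μ
  -- at or beyond the larger one.
  have hr2 : (w * √2 / 6 * (3 * b + D)) ^ 2 = w ^ 2 * (b / 3 * (D + 3 * b + 13)) := by
    have : (w * √2 / 6 * (3 * b + D)) ^ 2
        = w ^ 2 * √2 ^ 2 / 36 * (9 * b ^ 2 + 6 * b * D + D ^ 2) := by ring
    rw [this, h2, hD2]
    ring
  have hr : w * √2 / 6 * (3 * b + D) ≤ y := by
    refine abs_le_of_sq_le_sq' ?_ hy0 |>.2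
    rw [hr2, hw2, hy2]
    exact h
  have hr' : w * √2 / 6 * (3 * b - D) ≤ y :=
    le_trans (mul_nonpos_of_nonneg_of_nonpos (by positivity) (by linarith)) hy0
  have key := mul_nonneg (sub_nonneg.2 hr) (sub_nonneg.2 hr')
  have hexp : (y - w * √2 / 6 * (3 * b + D)) * (y - w * √2 / 6 * (3 * b - D))
      = y ^ 2 - b * √2 * w * y + w ^ 2 * √2 ^ 2 / 36 * (9 * b ^ 2 - D ^ 2) := by ring
  rw [hexp, h2, hD2, hy2, hw2] at key
  nlinarith

/-- If the sample mean is not much smaller than `μ`, and `u` is small enough in terms of `μ`,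
then the stopping inequality holds. -/
lemma stop_inequality {μ u a x : ℝ} (hμ : 0 ≤ μ) (hu : 0 ≤ u) (ha : 1 ≤ a) (hx : 0 ≤ x)
    (h : (a + 1) * (√2 * √μ * √u + 13 / 3 * u) ≤ μ)
    (hxμ : μ - (√2 * √μ * √u + u / 3) ≤ x) :
    a * (√2 * √x * √u + 7 / 3 * u) ≤ x := by
  -- For x ≤ μ, √x ≤ √μ and the linear terms total (7a+1)u/3, well within 13(a+1)u/3. For x ≥ μ, the
  -- inequality is propagated from μ up to x.
  rcases le_total x μ with hle | hle
  · have h1 : √2 * √x * √u ≤ √2 * √μ * √u := by gcongr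
    have h2 : a * (√2 * √x * √u) ≤ a * (√2 * √μ * √u) := by gcongr
    have h3 : 0 ≤ √2 * √μ * √u := by positivity
    nlinarith [mul_nonneg (sub_nonneg.2 ha) hu]
  · have hyz : √μ ≤ √x := Real.sqrt_le_sqrt hle
    set y := √μ with hy
    set z := √x with hz
    set w := √u with hw
    have hy0 : 0 ≤ y := Real.sqrt_nonneg _
    have hw0 : 0 ≤ w := Real.sqrt_nonneg _
    have hy2 : y ^ 2 = μ := Real.sq_sqrt hμ
    have hz2 : z ^ 2 = x := Real.sq_sqrt hx
    have h3 : 0 ≤ √2 * y * w := by positivity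
    have hau : 0 ≤ a * u := by positivity
    have h4 : a * (√2 * y * w + 7 / 3 * u) ≤ μ := by nlinarith
    have h5 : a * √2 * w * y ≤ y * y := by nlinarith
    rcases hy0.eq_or_lt with h0 | h0
    · have hμ0 : μ = 0 := by rw [← hy2, ← h0]; ring
      have hu0 : u = 0 := by
        rw [← h0, hμ0] at h
        nlinarith
      have : w = 0 := by rw [hw, hu0, Real.sqrt_zero]
      rw [this, hu0]
      simpa using hx
    · have h6 : a * √2 * w ≤ y := le_of_mul_le_mul_right h5 h0
      -- The product is the increment of z² - a√2wz from y to z.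
      have h7 : 0 ≤ (z - y) * (z + y - a * √2 * w) :=
        mul_nonneg (sub_nonneg.2 hyz) (by linarith)
      nlinarith

lemma stopCond_sampleBound {T : ℕ} {x : Fin T → ℝ} (hx : ∀ s, x s ∈ Set.Icc (0 : ℝ) 1)
    {μ v δ α : ℝ} (hμ : 0 < μ) (hvμ : v ≤ μ) (hL : 0 < Real.log (1 / δ))
    (hα : 0 ≤ α) (hT : sampleBound μ δ α ≤ T)
    (hdev : μ - sampleMean x (sampleBound μ δ α) ≤
      √2 * √v * √(Real.log (1 / δ) / (sampleBound μ δ α : ℕ))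
        + Real.log (1 / δ) / (3 * (sampleBound μ δ α : ℕ))) :
    StopCond δ α x (sampleBound μ δ α) := by
  have hceil := Nat.le_ceil ((α + 2) / (3 * μ) * Real.log (1 / δ)
      * (√(9 * α ^ 2 + 114 * α + 192) + 3 * α + 19))
  set t := sampleBound μ δ α with ht
  set L := Real.log (1 / δ) with hLd
  -- The summand 2 in t₀ ensures t ≥ 2 and puts the ceiling at t - 2, below the t - 1 that divides L
  -- in u.
  have htc : ((⌈(α + 2) / (3 * μ) * L
      * (√(9 * α ^ 2 + 114 * α + 192) + 3 * α + 19)⌉₊ : ℕ) : ℝ) = t - 2 := by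
    rw [ht, sampleBound]; push_cast; ring
  have ht2 : 2 ≤ t := by rw [ht, sampleBound]; omega
  have ht2' : (2 : ℝ) ≤ t := by exact_mod_cast ht2
  have ht1 : (0 : ℝ) < t - 1 := by linarith
  rw [htc] at hceil
  set u := L / (t - 1) with hu
  have hu0 : 0 < u := by positivity
  have hroot : u * ((α + 2) / 3 * (√(9 * (α + 2) ^ 2 + 78 * (α + 2)) + 3 * (α + 2) + 13))
      ≤ μ := by
    have e1 : 9 * (α + 2) ^ 2 + 78 * (α + 2) = 9 * α ^ 2 + 114 * α + 192 := by ring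
    have e2 : √(9 * α ^ 2 + 114 * α + 192) + 3 * (α + 2) + 13
      = √(9 * α ^ 2 + 114 * α + 192) + 3 * α + 19 := by ring
    rw [e1, e2, hu, div_mul_eq_mul_div, div_le_iff₀ ht1]
    have h3 : L * ((α + 2) / 3 * (√(9 * α ^ 2 + 114 * α + 192) + 3 * α + 19))
      = μ * ((α + 2) / (3 * μ) * L * (√(9 * α ^ 2 + 114 * α + 192) + 3 * α + 19)) := by
      field_simp
    rw [h3]
    exact mul_le_mul_of_nonneg_left (by linarith) hμ.le
  have hq := le_of_quadratic_root_le hμ.le hu0.le (by linarith : 0 < α + 2) hroot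
  have hLt : L / t ≤ u := div_le_div_of_nonneg_left hL.le ht1 (by linarith)
  have hm0 := sampleMean_nonneg t hx
  have hdev' : μ - (√2 * √μ * √u + u / 3) ≤ sampleMean x t := by
    have h1 : √2 * √v * √(L / t) ≤ √2 * √μ * √u := by gcongr
    have h2 : L / (3 * t) = L / t / 3 := by rw [mul_comm, div_mul_eq_div_div]
    linarith
  have hcond := stop_inequality (a := α + 1) hμ.le hu0.le (by linarith) hm0
    (by convert hq using 2; ring) hdev'
  have hS : √(sampleVar x t) * √(L / t) ≤ √(sampleMean x t) * √u := by
    rw [← Real.sqrt_mul' _ (by positivity), ← Real.sqrt_mul' _ hu0.le]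
    refine Real.sqrt_le_sqrt ?_
    have h1 := mul_le_mul_of_nonneg_right (sampleVar_le ht2 hT hx)
      (show 0 ≤ L / t by positivity)
    refine h1.trans (le_of_eq ?_)
    rw [hu]
    field_simp
  rw [StopCond, width, le_div_iff₀ (by linarith), mul_comm]
  refine le_trans ?_ hcond
  gcongr ?_ * (?_ + _)
  rw [mul_assoc, mul_assoc]
  gcongr

/-! ### Order of magnitude of t₀. -/

lemma sampleBound_le {α₀ δ₀ : ℝ} (hα₀ : 0 < α₀) (hδ₀ : δ₀ < 1) :
    ∃ C : ℝ, ∀ μ δ α : ℝ, 0 < μ → μ ≤ 1 → 0 < δ → δ ≤ δ₀ → α₀ ≤ α →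
      (sampleBound μ δ α : ℝ) ≤ C * (α ^ 2 / μ * Real.log (1 / δ)) := by
  set ℓ := Real.log (1 / δ₀) with hℓ
  set A := 1 / α₀ with hA
  -- Since Aα ≥ 1, constants are absorbed into multiples of α, and the root is at most 3α + 19. The
  -- last term pays for the additive 3: the 2 in t₀ plus 1 for the ceiling.
  refine ⟨(1 + 2 * A) * (6 + 38 * A) / 3 + 3 * A ^ 2 / ℓ, ?_⟩
  intro μ δ α hμ hμ1 hδ hδδ₀ hα
  have hδ₀0 : 0 < δ₀ := hδ.trans_le hδδ₀
  have hℓ0 : 0 < ℓ := Real.log_pos (by rw [lt_div_iff₀ hδ₀0]; linarith)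
  have hα0 : 0 < α := hα₀.trans_le hα
  have hLℓ : ℓ ≤ Real.log (1 / δ) :=
    Real.log_le_log (by positivity) (one_div_le_one_div_of_le hδ hδδ₀)
  set L := Real.log (1 / δ) with hL
  have hL0 : 0 < L := hℓ0.trans_le hLℓ
  have hA0 : 0 < A := by positivity
  have hAα : 1 ≤ A * α := by
    rw [hA, div_mul_eq_mul_div, one_mul, one_le_div hα₀]; exact hα
  have hsqrt : √(9 * α ^ 2 + 114 * α + 192) ≤ 3 * α + 19 :=
    Real.sqrt_le_iff.2 ⟨by positivity, by nlinarith⟩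
  have hceil := Nat.ceil_lt_add_one (a := (α + 2) / (3 * μ) * L
      * (√(9 * α ^ 2 + 114 * α + 192) + 3 * α + 19)) (by positivity)
  have hB : (sampleBound μ δ α : ℝ) ≤ (α + 2) / (3 * μ) * L
      * (√(9 * α ^ 2 + 114 * α + 192) + 3 * α + 19) + 3 := by
    rw [sampleBound]; push_cast; linarith
  have h1 : (α + 2) / (3 * μ) * L * (√(9 * α ^ 2 + 114 * α + 192) + 3 * α + 19)
      ≤ (1 + 2 * A) * (6 + 38 * A) / 3 * (α ^ 2 / μ * L) := by
    have h2 : (α + 2) * (√(9 * α ^ 2 + 114 * α + 192) + 3 * α + 19)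
        ≤ ((1 + 2 * A) * α) * ((6 + 38 * A) * α) :=
      mul_le_mul (by linarith) (by linarith) (by positivity) (by positivity)
    calc (α + 2) / (3 * μ) * L * (√(9 * α ^ 2 + 114 * α + 192) + 3 * α + 19)
        = (L / (3 * μ)) * ((α + 2) * (√(9 * α ^ 2 + 114 * α + 192) + 3 * α + 19)) := by ring
      _ ≤ (L / (3 * μ)) * (((1 + 2 * A) * α) * ((6 + 38 * A) * α)) := by gcongr
      _ = _ := by field_simp
  have h3 : 3 ≤ 3 * A ^ 2 / ℓ * (α ^ 2 / μ * L) := by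
    have h4 : 3 * A ^ 2 / ℓ * (α ^ 2 / μ * L) = 3 * ((A * α) ^ 2 * (L / ℓ) * (1 / μ)) := by
      field_simp
    rw [h4]
    have h5 : 1 ≤ (A * α) ^ 2 := one_le_pow₀ hAα
    have h6 : 1 ≤ L / ℓ := (one_le_div hℓ0).2 hLℓ
    have h7 : 1 ≤ 1 / μ := (one_le_div hμ).2 hμ1
    have := one_le_mul_of_one_le_of_one_le (one_le_mul_of_one_le_of_one_le h5 h6) h7
    linarith
  linarith

/-! ### From the deviation events to the theorem. -/

/-- The deviation events at all times imply both conclusions about the stopping rule. -/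
lemma conclusions_of_deviations {T : ℕ} {x : Fin T → ℝ} (hx : ∀ s, x s ∈ Set.Icc (0 : ℝ) 1)
    {μ v δ α : ℝ} (hμ : 0 < μ) (hv : 0 ≤ v) (hvμ : v ≤ μ) (hL : 0 < Real.log (1 / δ))
    (hα : 0 ≤ α) (hT : sampleBound μ δ α ≤ T)
    (hdev : ∀ t : ℕ, 2 ≤ t → ∀ h : t ≤ T,
      ∑ i : Fin t, x (Fin.castLE h i) - t * μ
          < √(2 * t * v * Real.log (1 / δ)) + Real.log (1 / δ) / 3 ∧
        t * μ - ∑ i : Fin t, x (Fin.castLE h i)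
          < √(2 * t * v * Real.log (1 / δ)) + Real.log (1 / δ) / 3 ∧
        √v < √(unbiasedVar fun i => x (Fin.castLE h i))
          + √(2 * (Real.log (1 / δ) / (t - 1)))) :
    stopTime δ α x ≤ (sampleBound μ δ α : ℕ∞) ∧
      ∀ t : ℕ, 2 ≤ t → t ≤ T → StopCond δ α x t →
        α / (α + 1) * sampleMean x t < μ ∧ μ < (α + 2) / (α + 1) * sampleMean x t := by
  have hmean : ∀ t : ℕ, 2 ≤ t → t ≤ T →
      |sampleMean x t - μ| < √2 * √v * √(Real.log (1 / δ) / t) + Real.log (1 / δ) / (3 * t) := by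
    intro t ht h
    have ht0 : (0 : ℝ) < t := by positivity
    obtain ⟨h1, h2, -⟩ := hdev t ht h
    rw [sqrt_bernstein_eq ht0 hv] at h1 h2
    have h3 : ∑ i : Fin t, x (Fin.castLE h i) = t * sampleMean x t := by
      rw [sampleMean_eq h]; field_simp
    have h4 : Real.log (1 / δ) / 3 = t * (Real.log (1 / δ) / (3 * t)) := by field_simp
    rw [h3, h4, ← mul_sub, ← mul_add] at h1 h2
    have h1 := lt_of_mul_lt_mul_left h1 ht0.le
    have h2 := lt_of_mul_lt_mul_left h2 ht0.le
    exact abs_lt.2 ⟨by linarith, h1⟩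
  have ht0 : 2 ≤ sampleBound μ δ α := by rw [sampleBound]; omega
  have hcond₀ : StopCond δ α x (sampleBound μ δ α) := by
    refine stopCond_sampleBound hx hμ hvμ hL hα hT ?_
    have := (abs_lt.1 (hmean _ ht0 hT)).1
    linarith
  refine ⟨iInf₂_le _ ⟨ht0, hT, hcond₀⟩, ?_⟩
  intro t ht h hcond
  have hsd := (hdev t ht h).2.2
  rw [← sampleVar_eq h] at hsd
  have hw := bernstein_width_le (by exact_mod_cast ht) hL hsd.le
  have hlt : |sampleMean x t - μ| < sampleMean x t / (α + 1) :=
    (hmean t ht h).trans_le (hw.trans hcond)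
  obtain ⟨h1, h2⟩ := abs_lt.1 hlt
  have e1 : α / (α + 1) * sampleMean x t = sampleMean x t - sampleMean x t / (α + 1) := by
    field_simp; ring
  have e2 : (α + 2) / (α + 1) * sampleMean x t
      = sampleMean x t + sampleMean x t / (α + 1) := by
    field_simp; ring
  constructor <;> linarith

lemma stopping_rule_probability {T : ℕ} {X : Fin T → Ω → ℝ} {μ δ α : ℝ}
    (hm : ∀ s, Measurable (X s)) (hb : ∀ s ω, X s ω ∈ Set.Icc (0 : ℝ) 1)
    (hind : iIndepFun X P) (hid : ∀ s r, IdentDistrib (X s) (X r) P P)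
    (hmean : ∀ s, ∫ ω, X s ω ∂P = μ) (hμ : 0 < μ) (hδ : 0 < δ) (hδ1 : δ < 1) (hα : 0 ≤ α)
    (hT : sampleBound μ δ α ≤ T) :
    1 - 3 * ((T : ℝ) - 1) * δ ≤
      P.real {ω | stopTime δ α (fun s => X s ω) ≤ (sampleBound μ δ α : ℕ∞) ∧
        ∀ t : ℕ, 2 ≤ t → t ≤ T → StopCond δ α (fun s => X s ω) t →
          α / (α + 1) * sampleMean (fun s => X s ω) t < μ ∧
          μ < (α + 2) / (α + 1) * sampleMean (fun s => X s ω) t} := by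
  have hT2 : 2 ≤ T := le_trans (by rw [sampleBound]; omega) hT
  let s₀ : Fin T := ⟨0, by omega⟩
  set L := Real.log (1 / δ) with hLdef
  have hL : 0 < L := Real.log_pos (by rw [lt_div_iff₀ hδ]; linarith)
  have hexp : Real.exp (-L) = δ := by
    rw [hLdef, one_div, Real.log_inv, neg_neg, Real.exp_log hδ]
  set q := ∫ ω, X s₀ ω ^ 2 ∂P with hq
  have hsq : ∀ s, ∫ ω, X s ω ^ 2 ∂P = q := fun s =>
    ((hid s s₀).comp (u := fun y : ℝ => y ^ 2) (by fun_prop)).integral_eq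
  have hXi : Integrable (X s₀) P := integrable_of_abs_le (hm s₀) 1 fun ω => by
    rw [abs_of_nonneg (hb s₀ ω).1]; exact (hb s₀ ω).2
  have hXi2 : Integrable (fun ω => X s₀ ω ^ 2) P :=
    integrable_of_abs_le ((hm s₀).pow_const 2) 1 fun ω => by
      rw [abs_pow, abs_of_nonneg (hb s₀ ω).1]; exact pow_le_one₀ (hb s₀ ω).1 (hb s₀ ω).2
  have hμ1 : μ ≤ 1 := by
    rw [← hmean s₀]
    have := integral_mono hXi (integrable_const (1 : ℝ)) fun ω => (hb s₀ ω).2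
    simpa using this
  have hqμ : q ≤ μ := by
    rw [← hmean s₀]
    exact integral_mono hXi2 hXi fun ω => by
      have := hb s₀ ω
      simp only
      nlinarith [this.1, this.2]
  have hv : 0 ≤ q - μ ^ 2 := by
    have h1 := variance_nonneg (X s₀) P
    rw [variance_eq_sub (MemLp.of_bound (hm s₀).aestronglyMeasurable 1
      (Filter.Eventually.of_forall fun ω => by
        rw [Real.norm_eq_abs, abs_of_nonneg (hb s₀ ω).1]; exact (hb s₀ ω).2))] at h1
    simpa [hmean s₀, hq] using h1
  let bad : ℕ → Set Ω := fun t => {ω | ∃ h : t ≤ T,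
    ¬(∑ i : Fin t, X (Fin.castLE h i) ω - t * μ < √(2 * t * (q - μ ^ 2) * L) + L / 3 ∧
      t * μ - ∑ i : Fin t, X (Fin.castLE h i) ω < √(2 * t * (q - μ ^ 2) * L) + L / 3 ∧
      √(q - μ ^ 2) < √(unbiasedVar fun i => X (Fin.castLE h i) ω) + √(2 * (L / (t - 1))))}
  have hbad : ∀ t ∈ Finset.Icc 2 T, P.real (bad t) ≤ 3 * δ := by
    intro t ht
    obtain ⟨ht2, htT⟩ := Finset.mem_Icc.1 ht
    have h1 := deviations_bound (P := P) ht2 (X := fun i => X (Fin.castLE htT i))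
      (fun i => hm _) (fun i => hb _) (hind.precomp (Fin.castLE_injective htT))
      (fun i => hmean _) (fun i => hsq _) ⟨hμ.le, hμ1⟩ hL
    rw [hexp] at h1
    refine le_trans (measureReal_mono ?_) h1
    rintro ω ⟨_, hω⟩
    exact hω
  have hunion : P.real (⋃ t ∈ Finset.Icc 2 T, bad t) ≤ 3 * ((T : ℝ) - 1) * δ := by
    refine (measureReal_biUnion_finset_le _ _).trans ((Finset.sum_le_sum hbad).trans ?_)
    rw [Finset.sum_const, Nat.card_Icc, nsmul_eq_mul, show T + 1 - 2 = T - 1 by omega,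
      Nat.cast_sub (by omega)]
    push_cast
    linarith
  set good := {ω | stopTime δ α (fun s => X s ω) ≤ (sampleBound μ δ α : ℕ∞) ∧
        ∀ t : ℕ, 2 ≤ t → t ≤ T → StopCond δ α (fun s => X s ω) t →
          α / (α + 1) * sampleMean (fun s => X s ω) t < μ ∧
          μ < (α + 2) / (α + 1) * sampleMean (fun s => X s ω) t} with hgood
  -- Covering the whole space and using subadditivity avoids having to prove `good` measurable.
  have hcover : Set.univ ⊆ good ∪ ⋃ t ∈ Finset.Icc 2 T, bad t := by
    intro ω _
    by_cases hω : ω ∈ ⋃ t ∈ Finset.Icc 2 T, bad t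
    · exact Or.inr hω
    · refine Or.inl (conclusions_of_deviations (fun s => hb s ω) hμ hv (by nlinarith) hL hα hT ?_)
      intro t ht h
      by_contra hcon
      exact hω (Set.mem_biUnion (Finset.mem_coe.2 (Finset.mem_Icc.2 ⟨ht, h⟩)) ⟨h, hcon⟩)
  have h1 := (measureReal_mono (μ := P) hcover).trans (measureReal_union_le _ _)
  rw [probReal_univ] at h1
  linarith

end MeanEstimation

theorem theorem8 {Ω : Type*} [MeasurableSpace Ω] (P : Measure Ω) [IsProbabilityMeasure P] :
    (∀ (T : ℕ) (X : Fin T → Ω → ℝ) (μ δ α : ℝ),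
      (∀ s, Measurable (X s)) →
      (∀ s ω, X s ω ∈ Set.Icc (0 : ℝ) 1) →
      iIndepFun X P →
      (∀ s r, IdentDistrib (X s) (X r) P P) →
      (∀ s, ∫ ω, X s ω ∂P = μ) →
      0 < μ → 0 < δ → δ < 1 → 0 ≤ α →
      MeanEstimation.sampleBound μ δ α ≤ T →
      1 - 3 * ((T : ℝ) - 1) * δ ≤
        P.real {ω |
          MeanEstimation.stopTime δ α (fun s => X s ω)
              ≤ (MeanEstimation.sampleBound μ δ α : ℕ∞) ∧
          ∀ t : ℕ, 2 ≤ t → t ≤ T → MeanEstimation.StopCond δ α (fun s => X s ω) t →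
            α / (α + 1) * MeanEstimation.sampleMean (fun s => X s ω) t < μ ∧
            μ < (α + 2) / (α + 1) * MeanEstimation.sampleMean (fun s => X s ω) t}) ∧
    (∀ α₀ δ₀ : ℝ, 0 < α₀ → δ₀ < 1 →
      ∃ C : ℝ, ∀ μ δ α : ℝ, 0 < μ → μ ≤ 1 → 0 < δ → δ ≤ δ₀ → α₀ ≤ α →
        (MeanEstimation.sampleBound μ δ α : ℝ) ≤ C * (α ^ 2 / μ * Real.log (1 / δ))) := by
  exact ⟨fun T X μ δ α hm hb hind hid hmean hμ hδ hδ1 hα hT =>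
      MeanEstimation.stopping_rule_probability hm hb hind hid hmean hμ hδ hδ1 hα hT,
    fun α₀ δ₀ hα₀ hδ₀ => MeanEstimation.sampleBound_le hα₀ hδ₀⟩
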